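/- Let $A,E\in\mathbb C^{n\times n}$ with $E$ invertible, $B\in\mathbb C^{n\times m}$, $C\in\mathbb C^{p\times n}$, $D\in\mathbb C^{p\times m}$, let $\|\cdot\|$ denote the spectral norm, and let $\varepsilon>0$ satisfy $\varepsilon\|D\|<1$. Write $\operatorname{spec}(M,E)=\{\lambda\in\mathbb C:\det(\lambda E-M)=0\}$, and define the $\varepsilon$-spectral value set $$\sigma_\varepsilon=\bigcup\{\operatorname{spec}(A+B\Delta(I-D\Delta)^{-1}C,\,E):\Delta\in\mathbb C^{m\times p},\ \|\Delta\|\le\varepsilon\},$$ its radius $\rho_\varepsilon=\max\{|\lambda|:\lambda\in\sigma_\varepsilon\}$, and the transfer function $G(\lambda)=C(\lambda E-A)^{-1}B+D$ for $\lambda\notin\operatorname{spec}(A,E)$. Put $\gamma=\varepsilon^{-1}$, $R_\gamma=D^*D-\gamma^2I$, $S_\gamma=DD^*-\gamma^2I$ and, for $r>0$, $$\mathcal S_{\gamma r}=\begin{bmatrix}A-BR_\gamma^{-1}D^*C&-\gamma BR_\gamma^{-1}B^*\\0&rE^*\end{bmatrix},\qquad \mathcal T_{\gamma r}=\begin{bmatrix}rE&0\\-\gamma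 C^*S_\gamma^{-1}C&A^*-C^*DR_\gamma^{-1}B^*\end{bmatrix}.$$ The pencil $(\mathcal S_{\gamma r},\mathcal T_{\gamma r})$ is called singular if $\det(\mathcal S_{\gamma r}-z\mathcal T_{\gamma r})=0$ for all $z\in\mathbb C$, and regular otherwise. Let $\eta>0$ be such that every eigenvalue of $(A,E)$ has modulus less than $\eta$ and the circle of radius $\eta$ centered at the origin lies in the interior of $\sigma_\varepsilon$. For $\theta\in[0,2\pi)$ let $R(\theta)=\{s>\eta: se^{\mathbf i\theta}\in\partial\sigma_\varepsilon\}$. Then the maximum defining $\rho_\varepsilon$ is attained; for every $\theta\in[0,2\pi)$ the set $R(\theta)$ is finite and nonempty, so that $\hat r(\theta)=\min R(\theta)>\eta$ is defined; and there is a largest $\delta>0$ such that for all $t\in[0,1]$ the circle of radius $\eta+t\delta$ centered at the origin is a subset of $\sigma_\varepsilon$. Suppose moreover that the largest singular value of $G(\lambda)$ is simple for every $\lambda$ with $|\lambda|=\eta+\delta$. Then one of the following holds: 1. $(\mathcal S_{\gamma r},\mathcal T_{\gamma r})$ is singular for $r=\eta+\delta$, and $\hat r(\theta)=\eta+\delta=\rho_\varepsilon$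 for every $\theta\in[0,2\pi)$; or 2. $(\mathcal S_{\gamma r},\mathcal T_{\gamma r})$ is regular for $r=\eta+\delta$ and, for $\theta$ uniformly distributed on $[0,2\pi)$, $\hat r(\theta)>\eta+\delta$ with probability one. -/

import Mathlib

open scoped Matrix.Norms.L2Operator

noncomputable section

namespace SpectralValueSet

/-- The (finite) eigenvalues of the square matrix pencil `(A, E)`, i.e. the roots of
`det (z E - A)`. -/
def pencilSpectrum {n : ℕ} (A E : Matrix (Fin n) (Fin n) ℂ) : Set ℂ :=
  {z : ℂ | (z • E - A).det = 0}

/-- The perturbed matrix `M(Δ) = A + B Δ (I - D Δ)⁻¹ C`. -/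
def perturbed {n m p : ℕ} (A : Matrix (Fin n) (Fin n) ℂ) (B : Matrix (Fin n) (Fin m) ℂ)
    (C : Matrix (Fin p) (Fin n) ℂ) (D : Matrix (Fin p) (Fin m) ℂ)
    (Δ : Matrix (Fin m) (Fin p) ℂ) : Matrix (Fin n) (Fin n) ℂ :=
  A + B * Δ * (1 - D * Δ)⁻¹ * C

/-- The `ε`-spectral value set: the union of the spectra of `(M(Δ), E)` over all complex `Δ` of
spectral norm at most `ε` (the norm on matrices is the `ℓ²` operator norm throughout). -/
def svs {n m p : ℕ} (ε : ℝ) (A : Matrix (Fin n) (Fin n) ℂ) (B : Matrix (Fin n) (Fin m) ℂ)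
    (C : Matrix (Fin p) (Fin n) ℂ) (D : Matrix (Fin p) (Fin m) ℂ)
    (E : Matrix (Fin n) (Fin n) ℂ) : Set ℂ :=
  {z : ℂ | ∃ Δ : Matrix (Fin m) (Fin p) ℂ, ‖Δ‖ ≤ ε ∧ z ∈ pencilSpectrum (perturbed A B C D Δ) E}

/-- The `ε`-spectral value set radius, the maximal modulus of a point of the spectral value set. -/
def svsRadius {n m p : ℕ} (ε : ℝ) (A : Matrix (Fin n) (Fin n) ℂ) (B : Matrix (Fin n) (Fin m) ℂ)
    (C : Matrix (Fin p) (Fin n) ℂ) (D : Matrix (Fin p) (Fin m) ℂ)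
    (E : Matrix (Fin n) (Fin n) ℂ) : ℝ :=
  sSup ((fun z : ℂ => ‖z‖) '' svs ε A B C D E)

/-- The transfer function `G(z) = C (z E - A)⁻¹ B + D`, meaningful for `z` outside the spectrum
of `(A, E)`. -/
def transfer {n m p : ℕ} (A : Matrix (Fin n) (Fin n) ℂ) (B : Matrix (Fin n) (Fin m) ℂ)
    (C : Matrix (Fin p) (Fin n) ℂ) (D : Matrix (Fin p) (Fin m) ℂ)
    (E : Matrix (Fin n) (Fin n) ℂ) (z : ℂ) : Matrix (Fin p) (Fin m) ℂ :=
  C * (z • E - A)⁻¹ * B + D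

/-- The largest singular value `‖G‖` of `G` is simple: `‖G‖²` is an eigenvalue of `Gᴴ G` of
multiplicity one. (Used for nonzero `G` only.) -/
def LargestSingularValueSimple {m p : ℕ} (G : Matrix (Fin p) (Fin m) ℂ) : Prop :=
  Module.finrank ℂ
    (Module.End.eigenspace (Matrix.toLin' (G.conjTranspose * G)) ((‖G‖ ^ 2 : ℝ) : ℂ)) = 1

/-- `R = Dᴴ D - γ² I`. -/
def matR {m p : ℕ} (γ : ℝ) (D : Matrix (Fin p) (Fin m) ℂ) : Matrix (Fin m) (Fin m) ℂ :=
  D.conjTranspose * D - ((γ : ℂ) ^ 2) • (1 : Matrix (Fin m) (Fin m) ℂ)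

/-- `S = D Dᴴ - γ² I`. -/
def matS {m p : ℕ} (γ : ℝ) (D : Matrix (Fin p) (Fin m) ℂ) : Matrix (Fin p) (Fin p) ℂ :=
  D * D.conjTranspose - ((γ : ℂ) ^ 2) • (1 : Matrix (Fin p) (Fin p) ℂ)

/-- The first matrix `𝒮_{γ r}` of the symplectic pencil for the circle of radius `r`. -/
def pencilS {n m p : ℕ} (γ r : ℝ) (A : Matrix (Fin n) (Fin n) ℂ) (B : Matrix (Fin n) (Fin m) ℂ)
    (C : Matrix (Fin p) (Fin n) ℂ) (D : Matrix (Fin p) (Fin m) ℂ)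
    (E : Matrix (Fin n) (Fin n) ℂ) : Matrix (Fin n ⊕ Fin n) (Fin n ⊕ Fin n) ℂ :=
  Matrix.fromBlocks
    (A - B * (matR γ D)⁻¹ * D.conjTranspose * C)
    (-((γ : ℂ) • (B * (matR γ D)⁻¹ * B.conjTranspose)))
    0
    ((r : ℂ) • E.conjTranspose)

/-- The second matrix `𝒯_{γ r}` of the symplectic pencil for the circle of radius `r`. -/
def pencilT {n m p : ℕ} (γ r : ℝ) (A : Matrix (Fin n) (Fin n) ℂ) (B : Matrix (Fin n) (Fin m) ℂ)
    (C : Matrix (Fin p) (Fin n) ℂ) (D : Matrix (Fin p) (Fin m) ℂ)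
    (E : Matrix (Fin n) (Fin n) ℂ) : Matrix (Fin n ⊕ Fin n) (Fin n ⊕ Fin n) ℂ :=
  Matrix.fromBlocks
    ((r : ℂ) • E)
    0
    (-((γ : ℂ) • (C.conjTranspose * (matS γ D)⁻¹ * C)))
    (A.conjTranspose - C.conjTranspose * D * (matR γ D)⁻¹ * B.conjTranspose)

/-- A square pencil `(S, T)` is regular if `det (S - z T)` does not vanish identically. -/
def IsRegularPencil {ι : Type} [Fintype ι] [DecidableEq ι] (S T : Matrix ι ι ℂ) : Prop :=
  ∃ z : ℂ, (S - z • T).det ≠ 0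

/-- A square pencil `(S, T)` is singular if `det (S - z T)` vanishes identically. -/
def IsSingularPencil {ι : Type} [Fintype ι] [DecidableEq ι] (S T : Matrix ι ι ℂ) : Prop :=
  ∀ z : ℂ, (S - z • T).det = 0

/-- The positive amounts `d` by which the circle of radius `η` about the origin can grow so that
all circles of radius `η + t d`, `t ∈ [0, 1]`, are subsets of `K`. -/
def growths (K : Set ℂ) (η : ℝ) : Set ℝ :=
  {d : ℝ | 0 < d ∧ ∀ t ∈ Set.Icc (0 : ℝ) 1, Metric.sphere (0 : ℂ) (η + t * d) ⊆ K}

/-- The radii, larger than `η`, of the boundary points of `K` on the ray with angle `θ`. -/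
def boundaryRadii (K : Set ℂ) (η θ : ℝ) : Set ℝ :=
  {s : ℝ | η < s ∧ (s : ℂ) * Complex.exp (θ * Complex.I) ∈ frontier K}

/-- The smallest of the boundary radii beyond `η` on the ray with angle `θ`. -/
def rHat (K : Set ℂ) (η θ : ℝ) : ℝ :=
  sInf (boundaryRadii K η θ)

/-- The uniform probability distribution on `[0, 2π)`. -/
def uniformAngle : MeasureTheory.Measure ℝ :=
  ProbabilityTheory.cond MeasureTheory.volume (Set.Ico (0 : ℝ) (2 * Real.pi))

end SpectralValueSet

end

/-!
Away from the eigenvalues of `(A, E)`, the spectral value set is the superlevel set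
`ε⁻¹ ≤ ‖G z‖` of the transfer function, and `‖G z‖ = ε⁻¹` on its boundary. By a Schur complement
argument, the symplectic pencil of the circle of radius `r` is singular at `w`, `‖w‖ = 1`, exactly
when `ε⁻¹` is some singular value of `G (r w)`. The boundary points on a ray are therefore zeros of
a nonzero polynomial in `r`, and for a regular pencil the boundary points on the circle are zeros
of a nonzero polynomial in `w`, so that almost every ray misses them.

If the pencil is singular, then `ε⁻¹` is a singular value of `G` on the whole circle and the
largest one at the point that stops its growth. Two distinct singular values have orthogonal
singular vectors, so in a limit the largest singular value can only meet `ε⁻¹` by becoming multiple.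
By simplicity and connectedness `‖G‖ = ε⁻¹` on the whole circle, and as `G z → D` for `z → ∞` with
`‖D‖ < ε⁻¹`, the maximum modulus principle gives `‖G‖ < ε⁻¹` outside it.
-/

namespace SpectralValueSet

open Matrix Set Metric

section SingularValues

variable {m p : Type*} [Fintype m] [DecidableEq m] [Fintype p] {G : Matrix p m ℂ} {σ : ℝ}

/-- `σ` is a singular value of `G` if `σ²` is an eigenvalue of `Gᴴ G`; the sign of `σ` is
ignored. -/
def IsSingularValue (G : Matrix p m ℂ) (σ : ℝ) : Prop :=
  Module.End.HasEigenvalue (toLin' (Gᴴ * G)) ((σ ^ 2 : ℝ) : ℂ)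

theorem isSingularValue_iff_mem_spectrum :
    IsSingularValue G σ ↔ ((σ ^ 2 : ℝ) : ℂ) ∈ spectrum ℂ (Gᴴ * G) := by
  rw [IsSingularValue, Module.End.hasEigenvalue_iff_mem_spectrum, spectrum_toLin']

theorem isSingularValue_iff_det_eq_zero :
    IsSingularValue G σ ↔ (Gᴴ * G - (σ : ℂ) ^ 2 • (1 : Matrix m m ℂ)).det = 0 := by
  rw [isSingularValue_iff_mem_spectrum, spectrum.mem_iff, IsUnit.sub_iff,
    isUnit_iff_isUnit_det, isUnit_iff_ne_zero, not_not, Algebra.algebraMap_eq_smul_one,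
    Complex.ofReal_pow]

open scoped MatrixOrder ComplexOrder in
theorem isSingularValue_norm (hG : G ≠ 0) : IsSingularValue G ‖G‖ := by
  have : Nonempty m := not_isEmpty_iff.1 fun _ => hG (Matrix.ext fun _ j => isEmptyElim j)
  have hGram : 0 ≤ Gᴴ * G := nonneg_iff_posSemidef.2 (posSemidef_conjTranspose_mul_self G)
  have h := spectrum.algebraMap_mem ℂ (CStarAlgebra.norm_mem_spectrum_of_nonneg hGram)
  rw [l2_opNorm_conjTranspose_mul_self, ← sq] at h
  exact isSingularValue_iff_mem_spectrum.2 h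

theorem IsSingularValue.abs_le_norm (h : IsSingularValue G σ) : |σ| ≤ ‖G‖ := by
  have hmem := isSingularValue_iff_mem_spectrum.1 h
  have : Nonempty m := not_isEmpty_iff.1 fun _ => by
    simp only [spectrum.of_subsingleton, mem_empty_iff_false] at hmem
  have hle := spectrum.norm_le_norm_of_mem hmem
  rw [l2_opNorm_conjTranspose_mul_self, Complex.norm_real, norm_pow, Real.norm_eq_abs, ← sq] at hle
  exact le_of_sq_le_sq hle (norm_nonneg G)

end SingularValues

theorem mul_lt_one_iff_lt_inv {F : Type*} [Field F] [LinearOrder F] [IsStrictOrderedRing F]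
    {a b : F} (ha : 0 < a) : a * b < 1 ↔ b < a⁻¹ := by
  rw [← lt_inv_mul_iff₀ ha, mul_one]

section SmallGain

variable {m p : Type*} [Fintype m] [DecidableEq m] [Fintype p] [DecidableEq p]
  {G : Matrix p m ℂ} {ε : ℝ}

theorem det_one_sub_mul_ne_zero {Δ : Matrix m p ℂ} (hG : ε * ‖G‖ < 1) (hΔ : ‖Δ‖ ≤ ε) :
    (1 - G * Δ).det ≠ 0 := by
  have hlt : ‖G * Δ‖ < 1 := calc
    ‖G * Δ‖ ≤ ‖G‖ * ‖Δ‖ := l2_opNorm_mul G Δ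
    _ ≤ ‖G‖ * ε := by gcongr
    _ < 1 := by rwa [mul_comm]
  exact ((isUnit_iff_isUnit_det _).1 (Units.oneSub _ hlt).isUnit).ne_zero

theorem det_one_sub_mul_smul_conjTranspose_eq_zero (hG : G ≠ 0) :
    (1 - G * (((‖G‖ : ℂ) ^ 2)⁻¹ • Gᴴ)).det = 0 := by
  have hnorm : (‖G‖ : ℂ) ^ 2 ≠ 0 := by simpa using hG
  have hfactor : (1 : Matrix m m ℂ) - (((‖G‖ : ℂ) ^ 2)⁻¹ • Gᴴ) * G =
      (-((‖G‖ : ℂ) ^ 2)⁻¹) • (Gᴴ * G - (‖G‖ : ℂ) ^ 2 • (1 : Matrix m m ℂ)) := by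
    rw [smul_sub, smul_smul, neg_mul, inv_mul_cancel₀ hnorm, Matrix.smul_mul]
    module
  rw [det_one_sub_mul_comm, hfactor, det_smul,
    isSingularValue_iff_det_eq_zero.1 (isSingularValue_norm hG), mul_zero]

theorem exists_norm_le_det_one_sub_mul_eq_zero_iff (hε : 0 < ε) :
    (∃ Δ : Matrix m p ℂ, ‖Δ‖ ≤ ε ∧ (1 - G * Δ).det = 0) ↔ ε⁻¹ ≤ ‖G‖ := by
  refine ⟨fun ⟨Δ, hΔ, hdet⟩ => ?_, fun hG => ?_⟩
  · contrapose! hdet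
    exact det_one_sub_mul_ne_zero ((mul_lt_one_iff_lt_inv hε).2 hdet) hΔ
  · have hpos : 0 < ‖G‖ := (inv_pos.2 hε).trans_le hG
    refine ⟨_, ?_, det_one_sub_mul_smul_conjTranspose_eq_zero (norm_pos_iff.1 hpos)⟩
    calc ‖((‖G‖ : ℂ) ^ 2)⁻¹ • Gᴴ‖ = ‖G‖⁻¹ := by
          rw [norm_smul, l2_opNorm_conjTranspose, norm_inv, norm_pow, Complex.norm_real, norm_norm]
          field_simp
      _ ≤ ε := inv_le_of_inv_le₀ hε hG

end SmallGain

section Schur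

variable {R k l : Type*} [CommRing R] [Fintype k] [DecidableEq k] [Fintype l] [DecidableEq l]

theorem det_mul_det_sub_mul_inv_mul {N : Matrix k k R} {P : Matrix l l R} (hN : IsUnit N)
    (hP : IsUnit P) (U : Matrix l k R) (V : Matrix k l R) :
    N.det * (P - U * N⁻¹ * V).det = P.det * (N - V * P⁻¹ * U).det := by
  have := hN.invertible
  have := hP.invertible
  rw [← invOf_eq_nonsing_inv, ← invOf_eq_nonsing_inv, ← det_fromBlocks₂₂, det_fromBlocks₁₁]

end Schur

theorem fromBlocks_sub {R k l o q : Type*} [AddCommGroup R] (A A' : Matrix o l R)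
    (B B' : Matrix o k R) (C C' : Matrix q l R) (D D' : Matrix q k R) :
    fromBlocks A B C D - fromBlocks A' B' C' D' =
      fromBlocks (A - A') (B - B') (C - C') (D - D') := by
  simp only [sub_eq_add_neg, fromBlocks_neg, fromBlocks_add]

section Membership

variable {n m p : ℕ} {A : Matrix (Fin n) (Fin n) ℂ} {B : Matrix (Fin n) (Fin m) ℂ}
  {C : Matrix (Fin p) (Fin n) ℂ} {D : Matrix (Fin p) (Fin m) ℂ} {E : Matrix (Fin n) (Fin n) ℂ}
  {ε : ℝ} {z : ℂ}

theorem isUnit_smul_sub (hz : z ∉ pencilSpectrum A E) : IsUnit (z • E - A) :=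
  (isUnit_iff_isUnit_det _).2 (isUnit_iff_ne_zero.2 hz)

theorem det_one_sub_mul_det_smul_sub_perturbed (hz : z ∉ pencilSpectrum A E)
    {Δ : Matrix (Fin m) (Fin p) ℂ} (hΔ : (1 - D * Δ).det ≠ 0) :
    (1 - D * Δ).det * (z • E - perturbed A B C D Δ).det =
      (z • E - A).det * (1 - transfer A B C D E z * Δ).det := by
  have hN : IsUnit (1 - D * Δ) := (isUnit_iff_isUnit_det _).2 (isUnit_iff_ne_zero.2 hΔ)
  convert det_mul_det_sub_mul_inv_mul hN (isUnit_smul_sub hz) (B * Δ) C using 3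
  · rw [perturbed, sub_sub]
  · rw [transfer, Matrix.add_mul, Matrix.mul_assoc _ B Δ, sub_add_eq_sub_sub_swap]

theorem mem_svs_iff (hε : 0 < ε) (hD : ε * ‖D‖ < 1) (hz : z ∉ pencilSpectrum A E) :
    z ∈ svs ε A B C D E ↔ ε⁻¹ ≤ ‖transfer A B C D E z‖ := by
  rw [← exists_norm_le_det_one_sub_mul_eq_zero_iff hε]
  refine exists_congr fun Δ => and_congr_right fun hΔ => ?_
  have hN := det_one_sub_mul_ne_zero hD hΔ
  have hdet := det_one_sub_mul_det_smul_sub_perturbed (B := B) (C := C) hz hN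
  rw [← mul_eq_zero_iff_left (show (z • E - A).det ≠ 0 from hz), ← hdet, mul_eq_zero_iff_left hN]
  rfl

end Membership

section SingularBlock

variable {m p : Type*} [Fintype m] [DecidableEq m] [Fintype p] [DecidableEq p]

/-- The matrix `[γ I, G; -Gᴴ, -γ I]`, which is singular exactly when `γ ≠ 0` is a singular value
of `G`. Unlike `Gᴴ G`, it is affine in `G` and `Gᴴ`. -/
def singularBlock (γ : ℝ) (G : Matrix p m ℂ) : Matrix (p ⊕ m) (p ⊕ m) ℂ :=
  fromBlocks ((γ : ℂ) • 1) G (-Gᴴ) (-((γ : ℂ) • 1))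

theorem det_singularBlock_eq_zero_iff {γ : ℝ} (hγ : γ ≠ 0) (G : Matrix p m ℂ) :
    (singularBlock γ G).det = 0 ↔ IsSingularValue G γ := by
  have hγ' : (γ : ℂ) ≠ 0 := Complex.ofReal_ne_zero.2 hγ
  let _ : Invertible ((γ : ℂ) • (1 : Matrix p p ℂ)) :=
    ⟨(γ : ℂ)⁻¹ • 1, by simp [-Complex.coe_smul, smul_smul, hγ'],
      by simp [-Complex.coe_smul, smul_smul, hγ']⟩
  have hSchur : -((γ : ℂ) • 1) - -Gᴴ * ⅟((γ : ℂ) • (1 : Matrix p p ℂ)) * G =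
      (γ : ℂ)⁻¹ • (Gᴴ * G - (γ : ℂ) ^ 2 • (1 : Matrix m m ℂ)) := by
    change -((γ : ℂ) • 1) - -Gᴴ * ((γ : ℂ)⁻¹ • (1 : Matrix p p ℂ)) * G = _
    rw [smul_sub, smul_smul, sq, inv_mul_cancel_left₀ hγ', Matrix.mul_smul, Matrix.mul_one,
      Matrix.smul_mul, Matrix.neg_mul]
    module
  rw [singularBlock, det_fromBlocks₁₁, hSchur, det_smul, det_smul, isSingularValue_iff_det_eq_zero]
  simp [hγ']

end SingularBlock

section Pencil

variable {n m p : ℕ} {A : Matrix (Fin n) (Fin n) ℂ} {B : Matrix (Fin n) (Fin m) ℂ}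
  {C : Matrix (Fin p) (Fin n) ℂ} {D : Matrix (Fin p) (Fin m) ℂ} {E : Matrix (Fin n) (Fin n) ℂ}
  {γ r : ℝ} {z : ℂ}

theorem isUnit_det_matR (hγ : ‖D‖ < γ) : IsUnit (matR γ D).det :=
  isUnit_iff_ne_zero.2 fun h =>
    ((le_abs_self γ).trans (isSingularValue_iff_det_eq_zero.2 h).abs_le_norm).not_gt hγ

theorem isUnit_det_matS (hγ : ‖D‖ < γ) : IsUnit (matS γ D).det := by
  have h := isUnit_det_matR (D := Dᴴ) (by rwa [l2_opNorm_conjTranspose])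
  rwa [matR, conjTranspose_conjTranspose] at h

theorem matS_inv_mul (hγ : ‖D‖ < γ) : (matS γ D)⁻¹ * D = D * (matR γ D)⁻¹ := by
  have hcomm : matS γ D * D = D * matR γ D := by
    simp [matS, matR, Matrix.sub_mul, Matrix.mul_sub, Matrix.mul_assoc]
  calc (matS γ D)⁻¹ * D = (matS γ D)⁻¹ * (D * matR γ D * (matR γ D)⁻¹) := by
        rw [mul_nonsing_inv_cancel_right _ _ (isUnit_det_matR hγ)]
    _ = D * (matR γ D)⁻¹ := by
        rw [← hcomm, Matrix.mul_assoc, nonsing_inv_mul_cancel_left _ _ (isUnit_det_matS hγ)]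

theorem singularBlock_inv (hγ : ‖D‖ < γ) :
    (singularBlock γ D)⁻¹ = fromBlocks (-((γ : ℂ) • (matS γ D)⁻¹)) (-((matS γ D)⁻¹ * D))
      ((matR γ D)⁻¹ * Dᴴ) ((γ : ℂ) • (matR γ D)⁻¹) := by
  have hR : (matR γ D)⁻¹ * (Dᴴ * D - (γ : ℂ) ^ 2 • 1) = 1 :=
    nonsing_inv_mul _ (isUnit_det_matR hγ)
  have hS : (matS γ D)⁻¹ * (D * Dᴴ - (γ : ℂ) ^ 2 • 1) = 1 :=
    nonsing_inv_mul _ (isUnit_det_matS hγ)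
  refine inv_eq_left_inv ?_
  rw [singularBlock, fromBlocks_multiply, ← fromBlocks_one]
  congr 1
  · refine Eq.trans ?_ hS
    simp [-Complex.coe_smul, Matrix.mul_sub, Matrix.mul_assoc, smul_smul, sq, neg_add_eq_sub]
  · simp
  · simp
  · refine Eq.trans ?_ hR
    simp [-Complex.coe_smul, Matrix.mul_sub, Matrix.mul_assoc, smul_smul, sq, ← sub_eq_add_neg]

theorem pencil_eq_fromBlocks_mul (hz : ‖z‖ = 1) (hγ : ‖D‖ < γ) :
    pencilS γ r A B C D E - z • pencilT γ r A B C D E =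
      fromBlocks 1 0 0 (z • 1) *
        (fromBlocks (-((r * z) • E - A)) 0 0 ((r * z) • E - A)ᴴ -
          fromBlocks 0 B Cᴴ 0 * (singularBlock γ D)⁻¹ * fromBlocks C 0 0 Bᴴ) := by
  have hzr : z * star (r * z) = r := by
    rw [star_mul', Complex.star_def, Complex.conj_ofReal, mul_left_comm,
      Complex.mul_conj', hz, Complex.ofReal_one, one_pow, mul_one]
  rw [singularBlock_inv hγ, matS_inv_mul hγ, pencilS, pencilT]
  simp only [fromBlocks_multiply, fromBlocks_smul, fromBlocks_sub]
  congr 1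
  · simp [-Complex.coe_smul, Matrix.mul_assoc, smul_smul, mul_comm z]
    abel
  · simp [Matrix.mul_assoc]
  · simp [Matrix.mul_assoc, smul_comm z]
  · simp only [conjTranspose_sub, conjTranspose_smul, Matrix.zero_mul, Matrix.smul_mul,
      Matrix.one_mul, smul_sub, smul_add, smul_smul, hzr, Matrix.mul_zero, zero_add, add_zero,
      Matrix.mul_assoc, Matrix.mul_neg, Matrix.neg_mul, sub_neg_eq_add]
    module

theorem fromBlocks_neg_conjTranspose_inv {F : Matrix (Fin n) (Fin n) ℂ} (hF : IsUnit F) :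
    fromBlocks (-F) 0 0 Fᴴ * fromBlocks (-F⁻¹) 0 0 F⁻¹ᴴ = 1 := by
  have hdet := (isUnit_iff_isUnit_det F).1 hF
  rw [fromBlocks_multiply, ← fromBlocks_one, ← conjTranspose_mul, neg_mul_neg,
    mul_nonsing_inv _ hdet, nonsing_inv_mul _ hdet]
  simp only [conjTranspose_one, Matrix.mul_zero, Matrix.zero_mul, add_zero, zero_add]

theorem singularBlock_sub_mul_inv_mul (hz : z ∉ pencilSpectrum A E) :
    singularBlock γ D - fromBlocks C 0 0 Bᴴ *
        (fromBlocks (-(z • E - A)) 0 0 (z • E - A)ᴴ)⁻¹ * fromBlocks 0 B Cᴴ 0 =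
      singularBlock γ (transfer A B C D E z) := by
  rw [inv_eq_right_inv (fromBlocks_neg_conjTranspose_inv (isUnit_smul_sub hz)), singularBlock,
    singularBlock, transfer, fromBlocks_multiply, fromBlocks_multiply, fromBlocks_sub]
  congr 1
  · simp
  · simp [add_comm]
  · simp [Matrix.mul_assoc]; abel
  · simp

theorem det_pencil_eq_zero_iff (hz : ‖z‖ = 1) (hγ : ‖D‖ < γ)
    (hs : (r * z : ℂ) ∉ pencilSpectrum A E) :
    (pencilS γ r A B C D E - z • pencilT γ r A B C D E).det = 0 ↔
      IsSingularValue (transfer A B C D E (r * z)) γ := by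
  have hγ0 : γ ≠ 0 := ((norm_nonneg D).trans_lt hγ).ne'
  have hz0 : z ≠ 0 := norm_ne_zero_iff.1 (hz.trans_ne one_ne_zero)
  have hP := isUnit_of_mul_isUnit_left
    ((fromBlocks_neg_conjTranspose_inv (isUnit_smul_sub hs)).symm ▸ isUnit_one)
  have hN : (singularBlock γ D).det ≠ 0 := fun h =>
    ((le_abs_self γ).trans
      ((det_singularBlock_eq_zero_iff hγ0 D).1 h).abs_le_norm).not_gt hγ
  have hexchange := det_mul_det_sub_mul_inv_mul
    ((isUnit_iff_isUnit_det _).2 (isUnit_iff_ne_zero.2 hN)) hP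
    (fromBlocks 0 B Cᴴ 0) (fromBlocks C 0 0 Bᴴ)
  rw [singularBlock_sub_mul_inv_mul hs] at hexchange
  rw [pencil_eq_fromBlocks_mul hz hγ, det_mul, det_fromBlocks_zero₂₁, det_one, det_smul, det_one,
    one_mul, mul_one, mul_eq_zero_iff_left (pow_ne_zero _ hz0), ← mul_eq_zero_iff_left hN,
    hexchange, mul_eq_zero_iff_left ((isUnit_iff_isUnit_det _).1 hP).ne_zero,
    det_singularBlock_eq_zero_iff hγ0]

end Pencil

section MatrixPencils

variable {𝕜 k : Type*} [Field 𝕜] [Fintype k] [DecidableEq k]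

theorem finite_setOf_det_sub_smul_eq_zero {S T : Matrix k k 𝕜} (h : ∃ z : 𝕜, (S - z • T).det ≠ 0) :
    {z : 𝕜 | (S - z • T).det = 0}.Finite := by
  open Polynomial in
  set q : 𝕜[X] := (S.map C - (X : 𝕜[X]) • T.map C).det with hq
  have heval (z : 𝕜) : q.eval z = (S - z • T).det := by
    rw [hq, ← Polynomial.coe_evalRingHom, RingHom.map_det]
    congr 1
    ext i j
    simp
    ring
  obtain ⟨z, hz⟩ := h
  have hq0 : q ≠ 0 := fun h0 => hz (by rw [← heval, h0, Polynomial.eval_zero])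
  simpa only [Polynomial.IsRoot, heval] using Polynomial.finite_setOfPred_isRoot hq0

theorem setOf_det_smul_sub_eq_zero {E : Matrix k k 𝕜} (hE : IsUnit E) (M : Matrix k k 𝕜) :
    {z : 𝕜 | (z • E - M).det = 0} = spectrum 𝕜 (E⁻¹ * M) := by
  have hdet := (isUnit_iff_isUnit_det E).1 hE
  ext z
  have hfactor : z • E - M = E * (algebraMap 𝕜 (Matrix k k 𝕜) z - E⁻¹ * M) := by
    rw [Matrix.mul_sub, mul_nonsing_inv_cancel_left _ _ hdet, Algebra.algebraMap_eq_smul_one,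
      Matrix.mul_smul, Matrix.mul_one]
  rw [mem_ofPred_eq, hfactor, det_mul, mul_eq_zero_iff_left hdet.ne_zero, spectrum.mem_iff,
    isUnit_iff_isUnit_det, isUnit_iff_ne_zero, not_not]

end MatrixPencils

theorem isCompact_biUnion_spectrum {𝕜 R : Type*} [NontriviallyNormedField 𝕜] [ProperSpace 𝕜]
    [NormedRing R] [NormedAlgebra 𝕜 R] [CompleteSpace R] {K : Set R} (hK : IsCompact K) :
    IsCompact (⋃ a ∈ K, spectrum 𝕜 a) := by
  obtain ⟨b, hb⟩ := hK.isBounded.exists_norm_le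
  have hclosed : IsClosed {q : R × 𝕜 | q.2 ∈ spectrum 𝕜 q.1} :=
    (Units.isOpen.isClosed_compl).preimage
      (((continuous_algebraMap 𝕜 R).comp continuous_snd).sub continuous_fst)
  convert ((hK.prod (isCompact_closedBall (0 : 𝕜) (b * ‖(1 : R)‖))).inter_right hclosed).image
    continuous_snd
  ext z
  simp only [mem_iUnion, mem_image, Prod.exists, exists_eq_right, exists_prop]
  refine exists_congr fun a => ⟨fun ⟨ha, hz⟩ => ⟨⟨ha, ?_⟩, hz⟩, fun ⟨⟨ha, _⟩, hz⟩ => ⟨ha, hz⟩⟩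
  rw [mem_closedBall_zero_iff]
  exact (spectrum.norm_le_norm_mul_of_mem hz).trans (by gcongr; exact hb a ha)

theorem continuousAt_nonsing_inv {X 𝕜 k : Type*} [TopologicalSpace X] [NormedField 𝕜]
    [HasSummableGeomSeries 𝕜] [Fintype k] [DecidableEq k] {M : X → Matrix k k 𝕜} {x : X}
    (hM : ContinuousAt M x) (hx : (M x).det ≠ 0) : ContinuousAt (fun y => (M y)⁻¹) x :=
  (continuousAt_matrix_inv (M x) (NormedRing.inverse_continuousAt (Units.mk0 _ hx))).comp hM

section SpectralValueSets

variable {n m p : ℕ} {A : Matrix (Fin n) (Fin n) ℂ} {B : Matrix (Fin n) (Fin m) ℂ}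
  {C : Matrix (Fin p) (Fin n) ℂ} {D : Matrix (Fin p) (Fin m) ℂ} {E : Matrix (Fin n) (Fin n) ℂ}
  {ε : ℝ} {z : ℂ}

theorem isClosed_pencilSpectrum : IsClosed (pencilSpectrum A E) :=
  isClosed_eq (by fun_prop) continuous_const

theorem finite_pencilSpectrum (hE : IsUnit E) : (pencilSpectrum A E).Finite := by
  rw [pencilSpectrum, setOf_det_smul_sub_eq_zero hE]
  exact finite_spectrum _

theorem continuousAt_transfer (hz : z ∉ pencilSpectrum A E) :
    ContinuousAt (transfer A B C D E) z := by
  have hinv : ContinuousAt (fun w : ℂ => (w • E - A)⁻¹) z :=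
    continuousAt_nonsing_inv (by fun_prop) hz
  unfold transfer
  fun_prop

theorem continuousOn_perturbed (hD : ε * ‖D‖ < 1) :
    ContinuousOn (perturbed A B C D) (closedBall 0 ε) := fun Δ hΔ => by
  have hinv : ContinuousAt (fun Δ : Matrix (Fin m) (Fin p) ℂ => (1 - D * Δ)⁻¹) Δ :=
    continuousAt_nonsing_inv (by fun_prop)
      (det_one_sub_mul_ne_zero hD (mem_closedBall_zero_iff.1 hΔ))
  refine ContinuousAt.continuousWithinAt ?_
  unfold perturbed
  fun_prop

theorem isCompact_svs (hE : IsUnit E) (hD : ε * ‖D‖ < 1) : IsCompact (svs ε A B C D E) := by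
  have : ProperSpace (Matrix (Fin m) (Fin p) ℂ) := FiniteDimensional.proper ℂ _
  have hK : IsCompact ((fun Δ => E⁻¹ * perturbed A B C D Δ) '' closedBall 0 ε) :=
    (isCompact_closedBall _ _).image_of_continuousOn
      (continuousOn_const.mul (continuousOn_perturbed hD))
  convert isCompact_biUnion_spectrum (𝕜 := ℂ) hK
  ext z
  simp only [svs, pencilSpectrum, setOf_det_smul_sub_eq_zero hE, mem_ofPred_eq, mem_iUnion,
    mem_image, mem_closedBall_zero_iff, exists_prop, exists_exists_and_eq_and]

theorem norm_transfer_eq_of_mem_frontier (hE : IsUnit E) (hε : 0 < ε) (hD : ε * ‖D‖ < 1)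
    (hz : z ∉ pencilSpectrum A E) (hf : z ∈ frontier (svs ε A B C D E)) :
    ‖transfer A B C D E z‖ = ε⁻¹ := by
  have hge := (mem_svs_iff hε hD hz).1 ((isCompact_svs hE hD).isClosed.frontier_subset hf)
  refine hge.antisymm' (not_lt.1 fun hlt => hf.2 (mem_interior_iff_mem_nhds.2 ?_))
  filter_upwards [(continuousAt_transfer hz).norm.eventually_const_lt hlt,
    isClosed_pencilSpectrum.isOpen_compl.mem_nhds hz] with w hw hwA
  exact (mem_svs_iff hε hD hwA).2 hw.le

end SpectralValueSets

theorem inter_frontier_nonempty_of_isPreconnected {X : Type*} [TopologicalSpace X] {s K : Set X}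
    (hs : IsPreconnected s) (hK : (s ∩ K).Nonempty) (hKc : (s ∩ Kᶜ).Nonempty) :
    (s ∩ frontier K).Nonempty := by
  by_contra hempty
  have hnot {x : X} (hx : x ∈ s) (hcl : x ∈ closure K) : x ∈ interior K :=
    by_contra fun hint => hempty ⟨x, hx, hcl, hint⟩
  obtain ⟨x, hxs, hxK⟩ := hK
  obtain ⟨y, hys, hyK⟩ := hKc
  obtain ⟨w, -, hwi, hwc⟩ := hs _ _ isOpen_interior isClosed_closure.isOpen_compl
    (fun w hw => (em (w ∈ closure K)).imp_left (hnot hw)) ⟨x, hxs, hnot hxs (subset_closure hxK)⟩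
    ⟨y, hys, fun hcl => hyK (interior_subset (hnot hys hcl))⟩
  exact hwc (subset_closure (interior_subset hwi))

theorem exists_pos_forall_norm_le_add_mem {V : Type*} [NormedAddCommGroup V] [NormedSpace ℝ V]
    [ProperSpace V] {K : Set V} {η : ℝ} (hη : 0 < η) (h : sphere (0 : V) η ⊆ interior K) :
    ∃ d > 0, ∀ z : V, η ≤ ‖z‖ → ‖z‖ ≤ η + d → z ∈ K := by
  obtain ⟨d, hd, hsub⟩ :=
    (isCompact_sphere (0 : V) η).exists_cthickening_subset_open isOpen_interior h
  refine ⟨d, hd, fun z hηz hzd => interior_subset (hsub ?_)⟩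
  have hz : 0 < ‖z‖ := hη.trans_le hηz
  have hdist : dist z ((η / ‖z‖) • z) = ‖z‖ - η := by
    calc dist z ((η / ‖z‖) • z) = ‖(1 - η / ‖z‖) • z‖ := by rw [dist_eq_norm, sub_smul, one_smul]
      _ = ‖z‖ - η := by
        rw [norm_smul, Real.norm_of_nonneg (sub_nonneg.2 ((div_le_one hz).2 hηz))]
        field_simp
  refine mem_cthickening_of_dist_le z ((η / ‖z‖) • z) d _ ?_ (by linarith)
  rw [mem_sphere_zero_iff_norm, norm_smul, Real.norm_of_nonneg (by positivity)]
  field_simp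

section Growth

variable {K : Set ℂ} {η δ θ s : ℝ}

theorem mem_growths_iff :
    δ ∈ growths K η ↔ 0 < δ ∧ ∀ z : ℂ, η ≤ ‖z‖ → ‖z‖ ≤ η + δ → z ∈ K := by
  refine and_congr_right fun hδ => ⟨fun h z hηz hzδ => ?_, fun h t ht z hz => ?_⟩
  · refine h ((‖z‖ - η) / δ) ⟨by have := sub_nonneg.2 hηz; positivity, ?_⟩ ?_
    · rw [div_le_one hδ]
      linarith
    · rw [mem_sphere_zero_iff_norm, div_mul_cancel₀ _ hδ.ne', add_sub_cancel]
  · rw [mem_sphere_zero_iff_norm] at hz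
    exact h z (by nlinarith [ht.1]) (by nlinarith [ht.2])

theorem bddAbove_growths (hK : Bornology.IsBounded K) (hη : 0 ≤ η) : BddAbove (growths K η) := by
  obtain ⟨b, hb⟩ := hK.exists_norm_le
  refine ⟨b, fun d hd => ?_⟩
  obtain ⟨z, hz⟩ := NormedSpace.sphere_nonempty (x := (0 : ℂ)).2 (add_nonneg hη hd.1.le)
  rw [mem_sphere_zero_iff_norm] at hz
  linarith [hb z ((mem_growths_iff.1 hd).2 z (by linarith [hd.1]) hz.le)]

theorem exists_isGreatest_growths (hK : IsCompact K) (hη : 0 < η)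
    (h : sphere (0 : ℂ) η ⊆ interior K) : ∃ δ, IsGreatest (growths K η) δ := by
  obtain ⟨d, hd, hdK⟩ := exists_pos_forall_norm_le_add_mem hη h
  have hdmem : d ∈ growths K η := mem_growths_iff.2 ⟨hd, hdK⟩
  have hbdd := bddAbove_growths hK.isBounded hη.le
  set δ := sSup (growths K η)
  have hδ : 0 < δ := hd.trans_le (le_csSup hbdd hdmem)
  have hopen : {z : ℂ | η < ‖z‖} ∩ ball 0 (η + δ) ⊆ K := fun z ⟨hηz, hzδ⟩ => by
    obtain ⟨e, he, hze⟩ := exists_lt_of_lt_csSup ⟨d, hdmem⟩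
      (sub_left_lt_of_lt_add (mem_ball_zero_iff.1 hzδ))
    exact (mem_growths_iff.1 he).2 z (le_of_lt hηz) (by linarith)
  refine ⟨δ, mem_growths_iff.2 ⟨hδ, fun z hηz hzδ => ?_⟩, fun e he => le_csSup hbdd he⟩
  rcases hηz.eq_or_lt with hz | hz
  · exact hdK z hηz (by linarith)
  · refine closure_minimal hopen hK.isClosed
      ((isOpen_lt continuous_const continuous_norm).inter_closure ⟨hz, ?_⟩)
    rwa [closure_ball _ (add_pos hη hδ).ne', mem_closedBall_zero_iff]

theorem exists_mem_sphere_notMem_interior (hη : 0 < η) (hδ : IsGreatest (growths K η) δ) :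
    ∃ z ∈ sphere (0 : ℂ) (η + δ), z ∉ interior K := by
  by_contra! hint
  obtain ⟨hδ0, hδK⟩ := mem_growths_iff.1 hδ.1
  obtain ⟨d, hd, hdK⟩ := exists_pos_forall_norm_le_add_mem (add_pos hη hδ0) hint
  have hmem : δ + d ∈ growths K η := mem_growths_iff.2 ⟨add_pos hδ0 hd, fun z hηz hzd =>
    (le_total ‖z‖ (η + δ)).elim (hδK z hηz) fun hz => hdK z hz (by linarith)⟩
  linarith [hδ.2 hmem]

theorem sphere_subset_of_mem_growths (hδ : δ ∈ growths K η) : sphere (0 : ℂ) (η + δ) ⊆ K := by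
  simpa only [one_mul] using hδ.2 1 ⟨zero_le_one, le_rfl⟩

theorem mem_boundaryRadii_iff : s ∈ boundaryRadii K η θ ↔ η < s ∧ circleMap 0 s θ ∈ frontier K := by
  rw [circleMap_zero]
  rfl

theorem boundaryRadii_nonempty (hK : Bornology.IsBounded K) (hη : 0 ≤ η)
    (h : sphere (0 : ℂ) η ⊆ interior K) (θ : ℝ) : (boundaryRadii K η θ).Nonempty := by
  obtain ⟨b, hηb, hKb⟩ := hK.subset_closedBall_lt η 0
  have hcont : Continuous fun s : ℝ => circleMap 0 s θ := by
    simp only [circleMap_zero]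
    fun_prop
  have hinner : circleMap 0 η θ ∈ interior K := h (circleMap_mem_sphere 0 hη θ)
  have houter : circleMap 0 (b + 1) θ ∉ K := fun hmem => by
    have := mem_closedBall_zero_iff.1 (hKb hmem)
    rw [norm_circleMap_zero, abs_of_pos (by linarith)] at this
    linarith
  obtain ⟨_, ⟨s, hs, rfl⟩, hfr⟩ := inter_frontier_nonempty_of_isPreconnected
    (isPreconnected_Icc.image _ hcont.continuousOn)
    ⟨_, mem_image_of_mem _ (left_mem_Icc.2 (by linarith)), interior_subset hinner⟩
    ⟨_, mem_image_of_mem _ (right_mem_Icc.2 (by linarith)), houter⟩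
  exact ⟨s, mem_boundaryRadii_iff.2 ⟨hs.1.lt_of_ne fun hsη => hfr.2 (hsη ▸ hinner), hfr⟩⟩

theorem isLeast_rHat (hfin : (boundaryRadii K η θ).Finite) (hne : (boundaryRadii K η θ).Nonempty) :
    IsLeast (boundaryRadii K η θ) (rHat K η θ) :=
  ⟨hne.csInf_mem hfin, fun _ hs => csInf_le hfin.bddBelow hs⟩

theorem add_le_of_mem_boundaryRadii (hη : 0 ≤ η) (hδ : δ ∈ growths K η)
    (hs : s ∈ boundaryRadii K η θ) : η + δ ≤ s := by
  by_contra! hlt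
  obtain ⟨hηs, hfr⟩ := mem_boundaryRadii_iff.1 hs
  have hnorm : ‖circleMap 0 s θ‖ = s := by
    rw [norm_circleMap_zero, abs_of_nonneg (hη.trans hηs.le)]
  refine hfr.2 (mem_interior_iff_mem_nhds.2 ?_)
  filter_upwards [continuous_norm.continuousAt.eventually_lt_const (hnorm.trans_lt hlt),
    continuous_norm.continuousAt.eventually_const_lt (hηs.trans_eq hnorm.symm)] with w hwδ hwη
  exact (mem_growths_iff.1 hδ).2 w hwη.le hwδ.le

theorem le_of_mem_boundaryRadii_of_subset_closedBall {r : ℝ} (hη : 0 ≤ η) (hK : K ⊆ closedBall 0 r)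
    (hs : s ∈ boundaryRadii K η θ) : s ≤ r := by
  obtain ⟨hηs, hfr⟩ := mem_boundaryRadii_iff.1 hs
  have hmem := closure_minimal hK isClosed_closedBall (frontier_subset_closure hfr)
  rwa [mem_closedBall_zero_iff, norm_circleMap_zero, abs_of_nonneg (hη.trans hηs.le)] at hmem

end Growth

theorem isGreatest_norm_image_of_sphere_subset {V : Type*} [NormedAddCommGroup V] [NormedSpace ℝ V]
    [Nontrivial V] {K : Set V} {r : ℝ} (hr : 0 ≤ r) (hsub : sphere 0 r ⊆ K)
    (hK : K ⊆ closedBall 0 r) : IsGreatest (norm '' K) r := by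
  obtain ⟨z, hz⟩ := NormedSpace.sphere_nonempty (x := (0 : V)).2 hr
  exact ⟨⟨z, hsub hz, mem_sphere_zero_iff_norm.1 hz⟩,
    forall_mem_image.2 fun w hw => mem_closedBall_zero_iff.1 (hK hw)⟩

section SimpleEigenvalues

variable {𝕜 k : Type*} [RCLike 𝕜] [Fintype k]

/-- The triples `(M, a, b)` such that `M` has two orthogonal eigenvectors with eigenvalues `a` and
`b`. The eigenvectors are normalised so that the set is closed; for Hermitian `M` it contains
all triples with `a ≠ b`, and `(M, a, a)` only if the eigenvalue `a` is multiple. -/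
def orthogonalEigenpairs (𝕜 k : Type*) [RCLike 𝕜] [Fintype k] : Set (Matrix k k 𝕜 × 𝕜 × 𝕜) :=
  {q | ∃ u ∈ sphere (0 : k → 𝕜) 1, ∃ v ∈ sphere (0 : k → 𝕜) 1,
    star u ⬝ᵥ v = 0 ∧ q.1 *ᵥ u = q.2.1 • u ∧ q.1 *ᵥ v = q.2.2 • v}

theorem isClosed_orthogonalEigenpairs : IsClosed (orthogonalEigenpairs 𝕜 k) := by
  have hclosed : IsClosed {q : (sphere (0 : k → 𝕜) 1 × sphere (0 : k → 𝕜) 1) ×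
      Matrix k k 𝕜 × 𝕜 × 𝕜 | star (q.1.1 : k → 𝕜) ⬝ᵥ (q.1.2 : k → 𝕜) = 0 ∧
        q.2.1 *ᵥ q.1.1 = q.2.2.1 • (q.1.1 : k → 𝕜) ∧
        q.2.1 *ᵥ q.1.2 = q.2.2.2 • (q.1.2 : k → 𝕜)} := by
    refine IsClosed.and (isClosed_eq ?_ continuous_const)
      (IsClosed.and (isClosed_eq ?_ ?_) (isClosed_eq ?_ ?_)) <;> fun_prop
  convert isClosedMap_snd_of_compactSpace _ hclosed using 1
  ext q
  simp only [orthogonalEigenpairs, mem_ofPred_eq, mem_image, Prod.exists, Subtype.exists,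
    exists_prop]
  aesop

variable [DecidableEq k] {M : Matrix k k 𝕜}

theorem exists_mem_sphere_mulVec_eq_smul {a : 𝕜} (h : Module.End.HasEigenvalue (toLin' M) a) :
    ∃ u ∈ sphere (0 : k → 𝕜) 1, M *ᵥ u = a • u := by
  obtain ⟨u, hu⟩ := h.exists_hasEigenvector
  refine ⟨(‖u‖⁻¹ : 𝕜) • u, ?_, ?_⟩
  · rw [mem_sphere_zero_iff_norm, norm_smul, norm_inv, norm_algebraMap', norm_norm,
      inv_mul_cancel₀ (norm_ne_zero_iff.2 hu.2)]
  · rw [mulVec_smul, ← toLin'_apply, hu.apply_eq_smul, smul_comm]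

theorem mem_orthogonalEigenpairs (hM : M.IsHermitian) {a b : ℝ} (hab : a ≠ b)
    (ha : Module.End.HasEigenvalue (toLin' M) (a : 𝕜))
    (hb : Module.End.HasEigenvalue (toLin' M) (b : 𝕜)) :
    (M, (a : 𝕜), (b : 𝕜)) ∈ orthogonalEigenpairs 𝕜 k := by
  obtain ⟨u, hu, hMu⟩ := exists_mem_sphere_mulVec_eq_smul ha
  obtain ⟨v, hv, hMv⟩ := exists_mem_sphere_mulVec_eq_smul hb
  refine ⟨u, hu, v, hv, ?_, hMu, hMv⟩
  have hsymm : star u ⬝ᵥ M *ᵥ v = star (M *ᵥ u) ⬝ᵥ v := by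
    rw [star_mulVec, dotProduct_mulVec, hM.eq]
  rw [hMu, hMv, star_smul, dotProduct_smul, smul_dotProduct, RCLike.star_def, RCLike.conj_ofReal,
    ← sub_eq_zero, ← sub_smul, smul_eq_zero, sub_eq_zero, RCLike.ofReal_inj] at hsymm
  exact hsymm.resolve_left hab.symm

open scoped ComplexOrder in
theorem notMem_orthogonalEigenpairs {a : 𝕜}
    (ha : Module.finrank 𝕜 (Module.End.eigenspace (toLin' M) a) = 1) :
    (M, a, a) ∉ orthogonalEigenpairs 𝕜 k := by
  rintro ⟨u, hu, v, hv, huv, hMu, hMv⟩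
  have hu0 : u ≠ 0 := ne_of_mem_sphere hu one_ne_zero
  obtain ⟨c, hc⟩ := (finrank_eq_one_iff_of_nonzero'
    (⟨u, Module.End.mem_eigenspace_iff.2 hMu⟩ : Module.End.eigenspace (toLin' M) a)
    (Subtype.coe_ne_coe.1 hu0)).1 ha ⟨v, Module.End.mem_eigenspace_iff.2 hMv⟩
  obtain rfl : c • u = v := congrArg Subtype.val hc
  rw [dotProduct_smul, smul_eq_zero, dotProduct_star_self_eq_zero] at huv
  exact ne_of_mem_sphere hv one_ne_zero (smul_eq_zero.2 huv)

theorem isClopen_setOf_eq_of_hasEigenvalue {X : Type*} [TopologicalSpace X]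
    {M : X → Matrix k k 𝕜} {a b : X → ℝ} (hM : Continuous M) (hHerm : ∀ x, (M x).IsHermitian)
    (ha : Continuous a) (hb : Continuous b)
    (hMa : ∀ x, Module.End.HasEigenvalue (toLin' (M x)) (a x : 𝕜))
    (hMb : ∀ x, Module.End.HasEigenvalue (toLin' (M x)) (b x : 𝕜))
    (hsimple : ∀ x, a x = b x →
      Module.finrank 𝕜 (Module.End.eigenspace (toLin' (M x)) (a x : 𝕜)) = 1) :
    IsClopen {x | a x = b x} := by
  refine ⟨isClosed_eq ha hb, ?_⟩
  have hcompl : {x | a x = b x} =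
      ((fun x => (M x, (a x : 𝕜), (b x : 𝕜))) ⁻¹' orthogonalEigenpairs 𝕜 k)ᶜ := by
    ext x
    refine ⟨fun hx => ?_, fun hx => not_not.1 fun hne =>
      hx (mem_orthogonalEigenpairs (hHerm x) hne (hMa x) (hMb x))⟩
    rw [mem_compl_iff, mem_preimage, ← show a x = b x from hx]
    exact notMem_orthogonalEigenpairs (hsimple x hx)
  rw [hcompl]
  exact (isClosed_orthogonalEigenpairs.preimage (by fun_prop)).isOpen_compl

end SimpleEigenvalues

theorem norm_eq_of_isSingularValue {X m p : Type*} [TopologicalSpace X] [PreconnectedSpace X]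
    [Fintype m] [DecidableEq m] [Fintype p] {G : X → Matrix p m ℂ} {σ : ℝ} (hG : Continuous G)
    (hσ : 0 < σ) (hsing : ∀ x, IsSingularValue (G x) σ)
    (hsimple : ∀ x, ‖G x‖ = σ → Module.finrank ℂ
      (Module.End.eigenspace (toLin' ((G x)ᴴ * G x)) ((‖G x‖ ^ 2 : ℝ) : ℂ)) = 1)
    {x₀ : X} (hx₀ : ‖G x₀‖ = σ) (x : X) : ‖G x‖ = σ := by
  have hG0 (x : X) : G x ≠ 0 :=
    norm_pos_iff.1 (hσ.trans_le ((le_abs_self σ).trans (hsing x).abs_le_norm))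
  have hsq (x : X) : ‖G x‖ ^ 2 = σ ^ 2 ↔ ‖G x‖ = σ := by
    rw [sq_eq_sq₀ (norm_nonneg _) hσ.le]
  have hGram : Continuous fun x => (G x)ᴴ * G x := by fun_prop
  have hclopen : IsClopen {x | ‖G x‖ ^ 2 = σ ^ 2} :=
    isClopen_setOf_eq_of_hasEigenvalue (𝕜 := ℂ) hGram
      (fun x => isHermitian_conjTranspose_mul_self (G x)) (hG.norm.pow 2) continuous_const
      (fun x => isSingularValue_norm (hG0 x)) hsing fun x hx => hsimple x ((hsq x).1 hx)
  exact (hsq x).1 (eq_univ_iff_forall.1 (hclopen.eq_univ ⟨x₀, (hsq x₀).2 hx₀⟩) x)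

section MaximumModulus

theorem norm_lt_of_forall_mem_sphere_norm_le {F : Type*} [NormedAddCommGroup F] [NormedSpace ℂ F]
    {f : ℂ → F} {c w : ℂ} {r γ : ℝ} (hr : 0 < r) (hf : DiffContOnCl ℂ f (ball c r))
    (hsphere : ∀ z ∈ sphere c r, ‖f z‖ ≤ γ) (hc : ‖f c‖ < γ) (hw : w ∈ ball c r) :
    ‖f w‖ < γ := by
  have hle (z : ℂ) (hz : z ∈ ball c r) : ‖f z‖ ≤ γ :=
    Complex.norm_le_of_forall_mem_frontier_norm_le isBounded_ball hf
      (by rwa [frontier_ball c hr.ne']) (subset_closure hz)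
  refine (hle w hw).lt_of_ne fun heq => ?_
  have hmax : IsMaxOn (norm ∘ f) (ball c r) w := fun z hz => (hle z hz).trans_eq heq.symm
  exact hc.ne ((Complex.norm_eqOn_of_isPreconnected_of_isMaxOn
    (convex_ball c r).isPreconnected isOpen_ball hf.differentiableOn hw hmax
    (mem_ball_self hr)).trans heq)

variable {n m p : ℕ} {A : Matrix (Fin n) (Fin n) ℂ} {B : Matrix (Fin n) (Fin m) ℂ}
  {C : Matrix (Fin p) (Fin n) ℂ} {D : Matrix (Fin p) (Fin m) ℂ} {E : Matrix (Fin n) (Fin n) ℂ}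
  {ε γ r : ℝ} {z w : ℂ}

/-- The transfer function in the coordinate `w = z⁻¹` at infinity, with value `D` at `w = 0`. -/
noncomputable def transferAtInfinity (A : Matrix (Fin n) (Fin n) ℂ) (B : Matrix (Fin n) (Fin m) ℂ)
    (C : Matrix (Fin p) (Fin n) ℂ) (D : Matrix (Fin p) (Fin m) ℂ)
    (E : Matrix (Fin n) (Fin n) ℂ) (w : ℂ) : Matrix (Fin p) (Fin m) ℂ :=
  w • (C * (E - w • A)⁻¹ * B) + D

theorem transferAtInfinity_zero : transferAtInfinity A B C D E 0 = D := by
  rw [transferAtInfinity, zero_smul, zero_add]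

theorem transferAtInfinity_inv (hz : z ≠ 0) (hs : z ∉ pencilSpectrum A E) :
    transferAtInfinity A B C D E z⁻¹ = transfer A B C D E z := by
  have hE : E - z⁻¹ • A = z⁻¹ • (z • E - A) := by rw [smul_sub, inv_smul_smul₀ hz]
  have hinv : (z⁻¹ • (z • E - A))⁻¹ = z • (z • E - A)⁻¹ := by
    simpa only [Units.smul_def, Units.val_inv_eq_inv_val, Units.val_mk0, inv_inv] using
      Matrix.inv_smul' (z • E - A) (Units.mk0 z⁻¹ (inv_ne_zero hz)) (isUnit_iff_ne_zero.2 hs)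
  rw [transferAtInfinity, transfer, hE, hinv, Matrix.mul_smul, Matrix.smul_mul, inv_smul_smul₀ hz]

theorem differentiableAt_transferAtInfinity (hw : IsUnit (E - w • A)) :
    DifferentiableAt ℂ (transferAtInfinity A B C D E) w := by
  have hinv : DifferentiableAt ℂ (fun w : ℂ => (E - w • A)⁻¹) w := by
    simp only [nonsing_inv_eq_ringInverse]
    exact DifferentiableAt.inverse (by fun_prop) hw
  let L : Matrix (Fin n) (Fin n) ℂ →L[ℂ] Matrix (Fin p) (Fin m) ℂ :=
    (mulRightLinearMap (Fin p) ℂ B ∘ₗ mulLeftLinearMap (Fin n) ℂ C).toContinuousLinearMap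
  exact (differentiableAt_id.smul (L.differentiableAt.comp w hinv)).add_const D

theorem isUnit_sub_smul (hE : IsUnit E) (hencl : ∀ z ∈ pencilSpectrum A E, ‖z‖ < r)
    (hw : ‖w‖ ≤ r⁻¹) : IsUnit (E - w • A) := by
  rcases eq_or_ne w 0 with rfl | hw0
  · rwa [zero_smul, sub_zero]
  have hs : w⁻¹ ∉ pencilSpectrum A E := fun h =>
    (hencl _ h).not_ge (by rw [norm_inv]; exact le_inv_of_le_inv₀ (norm_pos_iff.2 hw0) hw)
  have hfactor : E - w • A = w • (w⁻¹ • E - A) := by rw [smul_sub, smul_inv_smul₀ hw0]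
  rw [hfactor]
  exact (isUnit_smul_sub hs).smul (Units.mk0 w hw0)

theorem norm_transfer_lt (hE : IsUnit E) (hr : 0 < r) (hγ : ‖D‖ < γ)
    (hencl : ∀ z ∈ pencilSpectrum A E, ‖z‖ < r)
    (hsphere : ∀ z ∈ sphere 0 r, ‖transfer A B C D E z‖ ≤ γ) (hz : r < ‖z‖) :
    ‖transfer A B C D E z‖ < γ := by
  have hinv {z : ℂ} (hz : r ≤ ‖z‖) :
      transferAtInfinity A B C D E z⁻¹ = transfer A B C D E z :=
    transferAtInfinity_inv (norm_pos_iff.1 (hr.trans_le hz)) fun h => (hencl z h).not_ge hz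
  rw [← hinv hz.le]
  refine norm_lt_of_forall_mem_sphere_norm_le (inv_pos.2 hr)
    (DifferentiableOn.diffContOnCl fun w hw => ?_) (fun w hw => ?_)
    (by rwa [transferAtInfinity_zero])
    (by rw [mem_ball_zero_iff, norm_inv]; exact inv_strictAnti₀ hr hz)
  · rw [closure_ball _ (inv_pos.2 hr).ne', mem_closedBall_zero_iff] at hw
    exact (differentiableAt_transferAtInfinity
      (isUnit_sub_smul hE hencl hw)).differentiableWithinAt
  · have hw' : ‖w⁻¹‖ = r := by rw [norm_inv, mem_sphere_zero_iff_norm.1 hw, inv_inv]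
    rw [← inv_inv w, hinv hw'.ge]
    exact hsphere _ (mem_sphere_zero_iff_norm.2 hw')

theorem svs_subset_closedBall (hE : IsUnit E) (hε : 0 < ε) (hD : ε * ‖D‖ < 1) (hr : 0 < r)
    (hencl : ∀ z ∈ pencilSpectrum A E, ‖z‖ < r)
    (hsphere : ∀ z ∈ sphere 0 r, ‖transfer A B C D E z‖ ≤ ε⁻¹) :
    svs ε A B C D E ⊆ closedBall 0 r := fun z hz => by
  by_contra hout
  rw [mem_closedBall_zero_iff, not_le] at hout
  exact (norm_transfer_lt hE hr ((mul_lt_one_iff_lt_inv hε).1 hD) hencl hsphere hout).not_ge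
    ((mem_svs_iff hε hD fun h => (hencl z h).not_gt hout).1 hz)

end MaximumModulus

section BoundaryPoints

variable {n m p : ℕ} {A : Matrix (Fin n) (Fin n) ℂ} {B : Matrix (Fin n) (Fin m) ℂ}
  {C : Matrix (Fin p) (Fin n) ℂ} {D : Matrix (Fin p) (Fin m) ℂ} {E : Matrix (Fin n) (Fin n) ℂ}
  {ε γ r : ℝ} {z w : ℂ}

theorem det_pencil_eq_zero_of_mem_frontier (hE : IsUnit E) (hε : 0 < ε) (hD : ε * ‖D‖ < 1)
    (hw : ‖w‖ = 1) (hs : (r * w : ℂ) ∉ pencilSpectrum A E)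
    (hf : (r * w : ℂ) ∈ frontier (svs ε A B C D E)) :
    (pencilS ε⁻¹ r A B C D E - w • pencilT ε⁻¹ r A B C D E).det = 0 := by
  have hnorm := norm_transfer_eq_of_mem_frontier hE hε hD hs hf
  rw [det_pencil_eq_zero_iff hw ((mul_lt_one_iff_lt_inv hε).1 hD) hs, ← hnorm]
  exact isSingularValue_norm (norm_pos_iff.1 (hnorm ▸ inv_pos.2 hε))

theorem pencil_eq_smul_sub :
    pencilS γ r A B C D E - w • pencilT γ r A B C D E =
      (r : ℂ) • fromBlocks (-(w • E)) 0 0 Eᴴ -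
        (w • pencilT γ 0 A B C D E - pencilS γ 0 A B C D E) := by
  simp only [pencilS, pencilT, fromBlocks_smul, fromBlocks_sub, Complex.ofReal_zero, zero_smul]
  congr 1
  · rw [smul_neg, smul_comm w]
    module
  · simp
  · simp
  · module

theorem finite_setOf_det_pencil_eq_zero (hE : IsUnit E) (hw : w ≠ 0) :
    {r : ℝ | (pencilS γ r A B C D E - w • pencilT γ r A B C D E).det = 0}.Finite := by
  have hdet := ((isUnit_iff_isUnit_det E).1 hE).ne_zero
  have hunit : IsUnit (fromBlocks (-(w • E)) 0 0 Eᴴ) := by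
    rw [isUnit_iff_isUnit_det, isUnit_iff_ne_zero, det_fromBlocks_zero₂₁, det_neg, det_smul,
      det_conjTranspose]
    simp [hdet, hw]
  have hfin := finite_spectrum ((fromBlocks (-(w • E)) 0 0 Eᴴ)⁻¹ *
    (w • pencilT γ 0 A B C D E - pencilS γ 0 A B C D E))
  rw [← setOf_det_smul_sub_eq_zero hunit] at hfin
  simp only [pencil_eq_smul_sub]
  exact hfin.preimage Complex.ofReal_injective.injOn

theorem finite_boundaryRadii (hE : IsUnit E) (hε : 0 < ε) (hD : ε * ‖D‖ < 1) (η θ : ℝ) :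
    (boundaryRadii (svs ε A B C D E) η θ).Finite := by
  set w := Complex.exp (θ * Complex.I)
  have hw : w ≠ 0 := Complex.exp_ne_zero _
  have hinj : Function.Injective fun s : ℝ => (s * w : ℂ) :=
    (mul_left_injective₀ hw).comp Complex.ofReal_injective
  refine (((finite_pencilSpectrum (A := A) hE).preimage hinj.injOn).union
    (finite_setOf_det_pencil_eq_zero (A := A) (B := B) (C := C) (D := D) (γ := ε⁻¹) hE hw)).subset
    fun s hs => or_iff_not_imp_left.2 fun hspec => ?_
  exact det_pencil_eq_zero_of_mem_frontier hE hε hD (Complex.norm_exp_ofReal_mul_I θ) hspec hs.2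

theorem norm_div_ofReal_of_mem_sphere (hr : 0 < r) (hz : z ∈ sphere (0 : ℂ) r) :
    ‖z / r‖ = 1 := by
  rw [norm_div, mem_sphere_zero_iff_norm.1 hz, Complex.norm_of_nonneg hr.le, div_self hr.ne']

theorem finite_sphere_inter_frontier (hE : IsUnit E) (hε : 0 < ε) (hD : ε * ‖D‖ < 1) (hr : 0 < r)
    (hreg : IsRegularPencil (pencilS ε⁻¹ r A B C D E) (pencilT ε⁻¹ r A B C D E)) :
    (sphere (0 : ℂ) r ∩ frontier (svs ε A B C D E)).Finite := by
  refine ((finite_pencilSpectrum (A := A) hE).union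
    ((finite_setOf_det_sub_smul_eq_zero hreg).image (r * · : ℂ → ℂ))).subset
    fun z ⟨hz, hf⟩ => or_iff_not_imp_left.2 fun hspec => ?_
  have hzr : (r : ℂ) * (z / r) = z := mul_div_cancel₀ z (Complex.ofReal_ne_zero.2 hr.ne')
  exact ⟨z / r, det_pencil_eq_zero_of_mem_frontier hE hε hD (norm_div_ofReal_of_mem_sphere hr hz)
    (by rwa [hzr]) (by rwa [hzr]), hzr⟩

theorem ae_circleMap_notMem {Z : Set ℂ} (hZ : Z.Countable) (hr : r ≠ 0) :
    ∀ᵐ θ ∂uniformAngle, circleMap 0 r θ ∉ Z :=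
  ProbabilityTheory.cond_absolutelyContinuous.ae_le
    ((hZ.preimage_circleMap 0 hr).ae_notMem _)

theorem ae_notMem_boundaryRadii (hE : IsUnit E) (hε : 0 < ε) (hD : ε * ‖D‖ < 1) (hr : 0 < r)
    (hreg : IsRegularPencil (pencilS ε⁻¹ r A B C D E) (pencilT ε⁻¹ r A B C D E)) (η : ℝ) :
    ∀ᵐ θ ∂uniformAngle, r ∉ boundaryRadii (svs ε A B C D E) η θ := by
  filter_upwards [ae_circleMap_notMem
    (finite_sphere_inter_frontier hE hε hD hr hreg).countable hr.ne'] with θ hθ hmem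
  exact hθ ⟨circleMap_mem_sphere 0 hr.le θ, (mem_boundaryRadii_iff.1 hmem).2⟩

end BoundaryPoints

section SingularPencil

variable {n m p : ℕ} {A : Matrix (Fin n) (Fin n) ℂ} {B : Matrix (Fin n) (Fin m) ℂ}
  {C : Matrix (Fin p) (Fin n) ℂ} {D : Matrix (Fin p) (Fin m) ℂ} {E : Matrix (Fin n) (Fin n) ℂ}
  {ε γ r η δ : ℝ} {z : ℂ}

theorem isSingularValue_transfer_of_isSingularPencil (hγ : ‖D‖ < γ) (hr : 0 < r)
    (hsing : IsSingularPencil (pencilS γ r A B C D E) (pencilT γ r A B C D E))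
    (hz : z ∈ sphere 0 r) (hs : z ∉ pencilSpectrum A E) :
    IsSingularValue (transfer A B C D E z) γ := by
  have hzr : (r : ℂ) * (z / r) = z := mul_div_cancel₀ z (Complex.ofReal_ne_zero.2 hr.ne')
  rw [← hzr] at hs ⊢
  exact (det_pencil_eq_zero_iff (norm_div_ofReal_of_mem_sphere hr hz) hγ hs).1 (hsing _)

theorem norm_transfer_eq_on_sphere (hγ : ‖D‖ < γ) (hr : 0 < r)
    (hspec : ∀ z ∈ sphere 0 r, z ∉ pencilSpectrum A E)
    (hsing : IsSingularPencil (pencilS γ r A B C D E) (pencilT γ r A B C D E))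
    (hsimple : ∀ z ∈ sphere 0 r, ‖transfer A B C D E z‖ = γ →
      LargestSingularValueSimple (transfer A B C D E z))
    (hex : ∃ z ∈ sphere 0 r, ‖transfer A B C D E z‖ = γ) :
    ∀ z ∈ sphere 0 r, ‖transfer A B C D E z‖ = γ := by
  have : PreconnectedSpace (sphere (0 : ℂ) r) := isPreconnected_iff_preconnectedSpace.1
    (isPreconnected_sphere (by rw [Complex.rank_real_complex]; norm_num) 0 r)
  have hcont : Continuous fun z : sphere (0 : ℂ) r => transfer A B C D E z :=
    continuous_iff_continuousAt.2 fun z =>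
      (continuousAt_transfer (hspec z z.2)).comp continuous_subtype_val.continuousAt
  obtain ⟨z₀, hz₀, hnorm⟩ := hex
  intro z hz
  exact norm_eq_of_isSingularValue hcont ((norm_nonneg D).trans_lt hγ)
    (fun z => isSingularValue_transfer_of_isSingularPencil hγ hr hsing z.2 (hspec z z.2))
    (fun z => hsimple z z.2) (x₀ := ⟨z₀, hz₀⟩) hnorm ⟨z, hz⟩

theorem svs_subset_closedBall_of_isSingularPencil (hE : IsUnit E) (hε : 0 < ε)
    (hD : ε * ‖D‖ < 1) (hη : 0 < η) (hδ : IsGreatest (growths (svs ε A B C D E) η) δ)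
    (hencl : ∀ z ∈ pencilSpectrum A E, ‖z‖ < η + δ)
    (hsing : IsSingularPencil (pencilS ε⁻¹ (η + δ) A B C D E) (pencilT ε⁻¹ (η + δ) A B C D E))
    (hsimple : ∀ z ∈ sphere 0 (η + δ), ‖transfer A B C D E z‖ = ε⁻¹ →
      LargestSingularValueSimple (transfer A B C D E z)) :
    svs ε A B C D E ⊆ closedBall 0 (η + δ) := by
  have hr : 0 < η + δ := add_pos hη hδ.1.1
  have hspec (z : ℂ) (hz : z ∈ sphere 0 (η + δ)) : z ∉ pencilSpectrum A E := fun h =>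
    (hencl z h).ne (mem_sphere_zero_iff_norm.1 hz)
  obtain ⟨z₀, hz₀, hint⟩ := exists_mem_sphere_notMem_interior hη hδ
  have hfrontier : z₀ ∈ frontier (svs ε A B C D E) :=
    ⟨subset_closure (sphere_subset_of_mem_growths hδ.1 hz₀), hint⟩
  have hconst := norm_transfer_eq_on_sphere ((mul_lt_one_iff_lt_inv hε).1 hD) hr hspec hsing hsimple
    ⟨z₀, hz₀, norm_transfer_eq_of_mem_frontier hE hε hD (hspec z₀ hz₀) hfrontier⟩
  exact svs_subset_closedBall hE hε hD hr hencl fun z hz => (hconst z hz).le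

end SingularPencil

theorem isGreatest_svsRadius {n m p : ℕ} {A : Matrix (Fin n) (Fin n) ℂ}
    {B : Matrix (Fin n) (Fin m) ℂ} {C : Matrix (Fin p) (Fin n) ℂ} {D : Matrix (Fin p) (Fin m) ℂ}
    {E : Matrix (Fin n) (Fin n) ℂ} {ε : ℝ} (hE : IsUnit E) (hD : ε * ‖D‖ < 1)
    (hne : (svs ε A B C D E).Nonempty) :
    IsGreatest ((fun z : ℂ => ‖z‖) '' svs ε A B C D E) (svsRadius ε A B C D E) :=
  ((isCompact_svs hE hD).image continuous_norm).isGreatest_sSup (hne.image _)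

theorem isSingularPencil_or_isRegularPencil {ι : Type} [Fintype ι] [DecidableEq ι]
    (S T : Matrix ι ι ℂ) : IsSingularPencil S T ∨ IsRegularPencil S T :=
  or_iff_not_imp_left.2 not_forall.1

end SpectralValueSet

open SpectralValueSet Metric in
theorem mainTheorem1_general {n m p : ℕ} {A : Matrix (Fin n) (Fin n) ℂ}
    {B : Matrix (Fin n) (Fin m) ℂ} {C : Matrix (Fin p) (Fin n) ℂ} {D : Matrix (Fin p) (Fin m) ℂ}
    {E : Matrix (Fin n) (Fin n) ℂ} {ε η : ℝ} (hE : IsUnit E) (hε : 0 < ε) (hD : ε * ‖D‖ < 1)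
    (hη : 0 < η) (hint : sphere (0 : ℂ) η ⊆ interior (svs ε A B C D E)) :
    IsGreatest ((fun z : ℂ => ‖z‖) '' svs ε A B C D E) (svsRadius ε A B C D E) ∧
    (∀ θ : ℝ, (boundaryRadii (svs ε A B C D E) η θ).Finite ∧
      IsLeast (boundaryRadii (svs ε A B C D E) η θ) (rHat (svs ε A B C D E) η θ)) ∧
    ∃ δ : ℝ, IsGreatest (growths (svs ε A B C D E) η) δ ∧
      (IsRegularPencil (pencilS ε⁻¹ (η + δ) A B C D E) (pencilT ε⁻¹ (η + δ) A B C D E) →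
        ∀ᵐ θ ∂uniformAngle, η + δ < rHat (svs ε A B C D E) η θ) ∧
      (IsSingularPencil (pencilS ε⁻¹ (η + δ) A B C D E) (pencilT ε⁻¹ (η + δ) A B C D E) →
        (∀ z ∈ pencilSpectrum A E, ‖z‖ < η + δ) →
        (∀ z ∈ sphere 0 (η + δ), ‖transfer A B C D E z‖ = ε⁻¹ →
          LargestSingularValueSimple (transfer A B C D E z)) →
        η + δ = svsRadius ε A B C D E ∧ ∀ θ : ℝ, rHat (svs ε A B C D E) η θ = η + δ) := by
  have hK : IsCompact (svs ε A B C D E) := isCompact_svs hE hD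
  have hradius := isGreatest_svsRadius hE hD
    (((NormedSpace.sphere_nonempty.2 hη.le).mono hint).mono interior_subset)
  have hfin := finite_boundaryRadii (A := A) (B := B) (C := C) hE hε hD η
  have hleast (θ : ℝ) := isLeast_rHat (hfin θ) (boundaryRadii_nonempty hK.isBounded hη.le hint θ)
  obtain ⟨δ, hδ⟩ := exists_isGreatest_growths hK hη hint
  have hr : 0 < η + δ := add_pos hη hδ.1.1
  have hge (θ : ℝ) := add_le_of_mem_boundaryRadii hη.le hδ.1 (hleast θ).1
  refine ⟨hradius, fun θ => ⟨hfin θ, hleast θ⟩, δ, hδ, fun hreg => ?_,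
    fun hsing hencl hsimple => ?_⟩
  · filter_upwards [ae_notMem_boundaryRadii hE hε hD hr hreg η] with θ hθ
    exact (hge θ).lt_of_ne fun heq => hθ (heq ▸ (hleast θ).1)
  · have hball := svs_subset_closedBall_of_isSingularPencil hE hε hD hη hδ hencl hsing hsimple
    exact ⟨(isGreatest_norm_image_of_sphere_subset hr.le (sphere_subset_of_mem_growths hδ.1)
      hball).unique hradius, fun θ => (hge θ).antisymm'
        (le_of_mem_boundaryRadii_of_subset_closedBall hη.le hball (hleast θ).1)⟩

open SpectralValueSet in
theorem mainTheorem1 {n m p : ℕ}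
    (A : Matrix (Fin n) (Fin n) ℂ) (B : Matrix (Fin n) (Fin m) ℂ)
    (C : Matrix (Fin p) (Fin n) ℂ) (D : Matrix (Fin p) (Fin m) ℂ)
    (E : Matrix (Fin n) (Fin n) ℂ) (hE : IsUnit E)
    (ε : ℝ) (hε : 0 < ε) (hD : ε * ‖D‖ < 1)
    (η : ℝ) (hη : 0 < η)
    (hencl : ∀ z ∈ pencilSpectrum A E, ‖z‖ < η)
    (hint : Metric.sphere (0 : ℂ) η ⊆ interior (svs ε A B C D E)) :
    -- the spectral value set radius is an attained maximum
    IsGreatest ((fun z : ℂ => ‖z‖) '' svs ε A B C D E) (svsRadius ε A B C D E) ∧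
    -- on every ray there are finitely many boundary radii beyond `η`, with minimum `rHat`
    (∀ θ ∈ Set.Ico (0 : ℝ) (2 * Real.pi),
      (boundaryRadii (svs ε A B C D E) η θ).Finite ∧
      IsLeast (boundaryRadii (svs ε A B C D E) η θ) (rHat (svs ε A B C D E) η θ)) ∧
    -- the largest growth `δ` exists, and the dichotomy holds for it
    ∃ δ : ℝ, IsGreatest (growths (svs ε A B C D E) η) δ ∧
      ((∀ z ∈ Metric.sphere (0 : ℂ) (η + δ),
          LargestSingularValueSimple (transfer A B C D E z)) →
        (IsSingularPencil (pencilS ε⁻¹ (η + δ) A B C D E) (pencilT ε⁻¹ (η + δ) A B C D E) ∧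
          η + δ = svsRadius ε A B C D E ∧
          ∀ θ ∈ Set.Ico (0 : ℝ) (2 * Real.pi), rHat (svs ε A B C D E) η θ = η + δ) ∨
        (IsRegularPencil (pencilS ε⁻¹ (η + δ) A B C D E) (pencilT ε⁻¹ (η + δ) A B C D E) ∧
          ∀ᵐ θ ∂uniformAngle, η + δ < rHat (svs ε A B C D E) η θ)) := by
  obtain ⟨hradius, hray, δ, hδ, hreg, hsing⟩ := mainTheorem1_general hE hε hD hη hint
  exact ⟨hradius, fun θ _ => hray θ, δ, hδ, fun hsimple =>
    (isSingularPencil_or_isRegularPencil _ _).imp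
      (fun h => ⟨h, (hsing h (fun z hz => (hencl z hz).trans (lt_add_of_pos_right η hδ.1.1))
        fun z hz _ => hsimple z hz).imp_right fun hr θ _ => hr θ⟩) fun h => ⟨h, hreg h⟩⟩
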